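/- Let $N,L\ge 1$, let $\mathbf h_c,\mathbf h_s\in\mathbb C^{N}$ with $\mathbf h_s\neq 0$ be the communication and sensing channels, let $p_c,p_s,\alpha_s\ge 0$, and let $\mathbf s_s\in\mathbb C^{L}$ be a known deterministic sensing pulse with $L^{-1}\|\mathbf s_s\|^2=1$. Let $\mathbf s_c$ be a random vector in $\mathbb C^L$ with $\mathbb E\{\mathbf s_c\mathbf s_c^{\mathsf H}\}=\mathbf I_L$, let $\mathbf N_u\in\mathbb C^{N\times L}$ be independent of $\mathbf s_c$ with $\mathrm{vec}(\mathbf N_u)\sim\mathcal{CN}(\mathbf 0,\mathbf I)$, and put $\mathbf Z_c=\sqrt{p_c}\,\mathbf h_c\mathbf s_c^{\mathsf H}+\mathbf N_u$ (communication signal plus noise). In the uplink communications-centric (C-C) design $\mathbf Z_c$ is treated as Gaussian noise: it is replaced by a random matrix $\mathbf Z$ with $\mathrm{vec}(\mathbf Z)\sim\mathcal{CN}\big(\mathbf 0,\mathbb E\{\mathrm{vec}(\mathbf Z_c)\mathrm{vec}(\mathbf Z_c)^{\mathsf H}\}\big)$, independent of the target's reflection coefficient $\beta\sim\mathcal{CN}(0,\alpha_s)$.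 Here $\mathcal{CN}$ denotes the circularly symmetric complex Gaussian law. For a beamformer $\mathbf w\in\mathbb C^N$ with $\|\mathbf w\|=1$ let $$\mathbf Y=\sqrt{p_s}\,\beta\,\mathbf h_s\mathbf h_s^{\mathsf T}\mathbf w\,\mathbf s_s^{\mathsf H}+\mathbf Z ,\qquad \mathcal R(\mathbf w)=\frac1L\, I(\mathbf Y;\beta),$$ with mutual information $I$ measured in bits ($\mathbf w$ and $\mathbf s_s$ are known to the receiver). Then the sensing rate of the uplink C-C design, which uses $\mathbf w_s=\mathbf h_s^{*}/\|\mathbf h_s\|$, is finite and equals $$\mathcal R(\mathbf w_s)=\frac1L\log_2\!\left[1+p_sL\alpha_s\|\mathbf h_s\|^2\left(\|\mathbf h_s\|^2-\frac{p_c|\mathbf h_s^{\mathsf H}\mathbf h_c|^2}{1+p_c\|\mathbf h_c\|^2}\right)\right],$$ and this is the maximum of $\mathcal R(\mathbf w)$ over all $\mathbf w$ with $\|\mathbf w\|=1$. -/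

import Mathlib

open MeasureTheory ProbabilityTheory InformationTheory
open scoped ENNReal

noncomputable section

namespace UplinkISAC

/-- The matrix `E{X Xᴴ}` of a random vector `X` with complex entries. -/
def secondMoment {Ω ι : Type*} [MeasurableSpace Ω] (X : Ω → ι → ℂ) (P : Measure Ω) :
    Matrix ι ι ℂ :=
  Matrix.of fun i j => ∫ ω, X ω i * star (X ω j) ∂P

/-- `X ∼ 𝒞𝒩(0, R)`: the random vector `X` is circularly symmetric complex Gaussian, that is
(jointly, as a real random vector) Gaussian with mean zero, covariance `E{X Xᴴ} = R` and
pseudo-covariance `E{X Xᵀ} = 0`. -/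
structure IsCSCG {Ω ι : Type*} [MeasurableSpace Ω] [Fintype ι]
    (X : Ω → ι → ℂ) (R : Matrix ι ι ℂ) (P : Measure Ω) : Prop where
  hasGaussianLaw : HasGaussianLaw X P
  mean_eq : ∀ i, ∫ ω, X ω i ∂P = 0
  covariance_eq : secondMoment X P = R
  pseudoCovariance_eq : ∀ i j, ∫ ω, X ω i * X ω j ∂P = 0

/-- `b ∼ 𝒞𝒩(0, α)` for a complex random variable `b`. -/
def IsScalarCSCG {Ω : Type*} [MeasurableSpace Ω] (b : Ω → ℂ) (α : ℝ) (P : Measure Ω) : Prop :=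
  IsCSCG (fun ω (_ : Fin 1) => b ω) (Matrix.of fun _ _ => (α : ℂ)) P

/-- Mutual information `I(X; Y)` in nats: the Kullback-Leibler divergence of the joint law from
the product of the marginal laws. -/
def mutualInfo {Ω E F : Type*} [MeasurableSpace Ω] [MeasurableSpace E] [MeasurableSpace F]
    (X : Ω → E) (Y : Ω → F) (P : Measure Ω) : ℝ≥0∞ :=
  klDiv (P.map fun ω => (X ω, Y ω)) ((P.map X).prod (P.map Y))

/-- Mutual information in bits. -/
def mutualInfoBits {Ω E F : Type*} [MeasurableSpace Ω] [MeasurableSpace E] [MeasurableSpace F]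
    (X : Ω → E) (Y : Ω → F) (P : Measure Ω) : ℝ≥0∞ :=
  mutualInfo X Y P / ENNReal.ofReal (Real.log 2)

variable {N L : ℕ}

/-- The target response matrix `G = β h_s h_sᵀ`. -/
def targetResponse (b : ℂ) (hs : EuclideanSpace ℂ (Fin N)) : Matrix (Fin N) (Fin N) ℂ :=
  b • Matrix.vecMulVec hs.ofLp hs.ofLp

/-- The echo `√p_s G w s_sᴴ`. -/
def echo (ps : ℝ) (hs w : EuclideanSpace ℂ (Fin N)) (ss : EuclideanSpace ℂ (Fin L)) (b : ℂ) :
    Matrix (Fin N) (Fin L) ℂ :=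
  (Real.sqrt ps : ℂ) •
    Matrix.vecMulVec ((targetResponse b hs).mulVec w.ofLp) (star ss.ofLp)

/-- The aggregate interference-plus-noise `Z_c = √p_c h_c s_cᴴ + N_u`. -/
def interferencePlusNoise (pc : ℝ) (hc : EuclideanSpace ℂ (Fin N)) (sc : Fin L → ℂ)
    (Nu : Matrix (Fin N) (Fin L) ℂ) : Matrix (Fin N) (Fin L) ℂ :=
  (Real.sqrt pc : ℂ) • Matrix.vecMulVec hc.ofLp (star sc) + Nu

/-- The sensing beamformer `w_s = h_s^* / ‖h_s‖`. -/
def sensingBeamformer (hs : EuclideanSpace ℂ (Fin N)) : EuclideanSpace ℂ (Fin N) :=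
  ((‖hs‖⁻¹ : ℝ) : ℂ) • WithLp.toLp 2 (star hs.ofLp)

/-- The sensing rate: the mutual information, in bits per time slot, between the reflection
coefficient `β` and the received signal `Y = √p_s G w s_sᴴ + Z`, where `Z` is the disturbance.
The transmitted waveform is deterministic and known to the receiver, so that conditioning on it
is the same as fixing `w` and `s_s`. -/
def sensingRate {Ω : Type*} [MeasurableSpace Ω] (ps : ℝ) (hs w : EuclideanSpace ℂ (Fin N))
    (ss : EuclideanSpace ℂ (Fin L)) (β : Ω → ℂ) (Z : Ω → Matrix (Fin N) (Fin L) ℂ)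
    (P : Measure Ω) : ℝ≥0∞ :=
  mutualInfoBits (fun ω => (echo ps hs w ss (β ω) + Z ω).vec) β P / (L : ℝ≥0∞)

end UplinkISAC

end

/-! After vectorization the received signal is `β a + Z`, where `a` is a multiple of `s_s^* ⊗ h_s`
and `Z` is circular Gaussian with covariance `R = I ⊗ (I + p_c h_c h_cᴴ)`. The cross terms of `R`
vanish because `N_u` is centred and independent of `s_c`.

For `a ≠ 0`, put `q = aᴴ R⁻¹ a` and let `c = q⁻¹ aᴴ R⁻¹` be the whitened matched filter, so `c a =
1`. The scalar `V = c Z` is circular Gaussian of variance `1/q`, and the residual `W = Z - V a` has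
zero covariance and pseudo-covariance with `V`. Joint Gaussianity then makes `W` independent of `V`,
hence of `(β, V)`. Since `β a + Z = (β + V) a + W` and `c (β a + Z) = β + V`, data processing in one
direction (`mutualInfo_comp_le`) and the irrelevance of `W` in the other
(`mutualInfo_comp_indep_le`) reduce the problem to the scalar channel `β + V`. Its information, `log
(1 + α_s q)`, comes from explicit densities (`mutualInfo_add_eq_log`).

The Sherman–Morrison formula gives `q = p_s |h_sᵀ w|² L κ`, with `κ > 0` independent of `w`. The
rate thus increases with `|h_sᵀ w|`, which Cauchy–Schwarz bounds by `‖h_s‖`, with equality at `w_s`.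
-/

namespace UplinkISAC

/-! ### Data processing and independence for mutual information. -/

section MutualInformation

variable {Ω E F G H : Type*} [MeasurableSpace Ω] [MeasurableSpace E] [MeasurableSpace F]
  [MeasurableSpace G] [MeasurableSpace H] {P : Measure Ω} [IsProbabilityMeasure P]

/-- Data processing: a function of the observation carries no more information. -/
lemma mutualInfo_comp_le {X : Ω → E} {Y : Ω → F} (hX : AEMeasurable X P) (hY : AEMeasurable Y P)
    {f : E → G} (hf : Measurable f) :
    mutualInfo (fun ω => f (X ω)) Y P ≤ mutualInfo X Y P := by
  have := Measure.isProbabilityMeasure_map hX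
  have := Measure.isProbabilityMeasure_map hY
  have := Measure.isProbabilityMeasure_map (hX.prodMk hY)
  have h := klDiv_map_le (P.map fun ω => (X ω, Y ω)) ((P.map X).prod (P.map Y))
    (g := Prod.map f id) (by fun_prop)
  rw [AEMeasurable.map_map_of_aemeasurable (by fun_prop) (hX.prodMk hY),
    ← Measure.map_prod_map _ _ hf measurable_id,
    AEMeasurable.map_map_of_aemeasurable hf.aemeasurable hX, Measure.map_id] at h
  exact h

/-- Side information `W` that is jointly independent of `(T, Y)` does not increase the mutual
information. -/
lemma mutualInfo_comp_indep_le {T : Ω → E} {Y : Ω → F} {W : Ω → G}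
    (hT : AEMeasurable T P) (hY : AEMeasurable Y P) (hW : AEMeasurable W P)
    (hTW : IndepFun (fun ω => (T ω, Y ω)) W P)
    {g : E × G → H} (hg : Measurable g) :
    mutualInfo (fun ω => g (T ω, W ω)) Y P ≤ mutualInfo T Y P := by
  have := Measure.isProbabilityMeasure_map hT
  have := Measure.isProbabilityMeasure_map hY
  have := Measure.isProbabilityMeasure_map hW
  have := Measure.isProbabilityMeasure_map (hT.prodMk hY)
  have hjoint := (indepFun_iff_map_prod_eq_prod_map_map (hT.prodMk hY) hW).1 hTW
  have hTW' : IndepFun T W P := hTW.comp measurable_fst measurable_id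
  have hpair := (indepFun_iff_map_prod_eq_prod_map_map hT hW).1 hTW'
  let k : (E × F) × G → H × F := fun z => (g (z.1.1, z.2), z.1.2)
  have hk : Measurable k := by fun_prop
  -- Adjoin `W` to both the joint law and the product law of `(T, Y)`, then push both forward by
  -- `k`; divergence can only decrease.
  have h := klDiv_map_le ((P.map fun ω => (T ω, Y ω)).prod (P.map W))
    (((P.map T).prod (P.map Y)).prod (P.map W)) hk
  have hl : ((P.map fun ω => (T ω, Y ω)).prod (P.map W)).map k
      = P.map fun ω => (g (T ω, W ω), Y ω) := by
    rw [← hjoint, AEMeasurable.map_map_of_aemeasurable hk.aemeasurable ((hT.prodMk hY).prodMk hW)]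
    rfl
  have hr : (((P.map T).prod (P.map Y)).prod (P.map W)).map k
      = (P.map fun ω => g (T ω, W ω)).prod (P.map Y) := by
    have h1 : (P.map fun ω => g (T ω, W ω)) = ((P.map T).prod (P.map W)).map g := by
      rw [← hpair, AEMeasurable.map_map_of_aemeasurable hg.aemeasurable (hT.prodMk hW)]
      rfl
    rw [h1]
    refine Measure.ext_of_lintegral _ fun φ hφ => ?_
    rw [lintegral_map hφ hk, lintegral_prod _ (by fun_prop), lintegral_prod _ (by fun_prop),
      lintegral_prod _ (by fun_prop), lintegral_map (hφ.lintegral_prod_right') hg,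
      lintegral_prod _ (by fun_prop)]
    refine lintegral_congr fun t => ?_
    rw [lintegral_lintegral_swap (by fun_prop)]
  -- Independence makes the law of `W` a common product factor, which does not contribute to the
  -- divergence.
  rw [hl, hr, ← Measure.compProd_const (μ := P.map fun ω => (T ω, Y ω)),
    ← Measure.compProd_const (μ := (P.map T).prod (P.map Y)), klDiv_compProd_left] at h
  exact h

lemma mutualInfo_eq_zero_of_indepFun {X : Ω → E} {Y : Ω → F}
    (hX : AEMeasurable X P) (hY : AEMeasurable Y P) (h : IndepFun X Y P) :
    mutualInfo X Y P = 0 := by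
  have := Measure.isProbabilityMeasure_map hX
  have := Measure.isProbabilityMeasure_map hY
  rw [mutualInfo, (indepFun_iff_map_prod_eq_prod_map_map hX hY).1 h, klDiv_self]

/-- If `X` is independent of `(Y, Z)` and `Y` of `Z`, then `(X, Y)` is independent of `Z`. -/
lemma indepFun_prodMk_of_indepFun {X : Ω → E} {Y : Ω → F} {Z : Ω → G}
    (hX : AEMeasurable X P) (hY : AEMeasurable Y P) (hZ : AEMeasurable Z P)
    (h : IndepFun X (fun ω => (Y ω, Z ω)) P) (hYZ : IndepFun Y Z P) :
    IndepFun (fun ω => (X ω, Y ω)) Z P := by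
  have := Measure.isProbabilityMeasure_map hX
  have := Measure.isProbabilityMeasure_map hY
  have := Measure.isProbabilityMeasure_map hZ
  have hXY : IndepFun X Y P := h.comp measurable_id measurable_fst
  rw [indepFun_iff_map_prod_eq_prod_map_map hX (hY.prodMk hZ),
    (indepFun_iff_map_prod_eq_prod_map_map hY hZ).1 hYZ] at h
  rw [indepFun_iff_map_prod_eq_prod_map_map (hX.prodMk hY) hZ,
    (indepFun_iff_map_prod_eq_prod_map_map hX hY).1 hXY,
    ← (measurePreserving_prodAssoc (P.map X) (P.map Y) (P.map Z)).symm.map_eq, ← h,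
    AEMeasurable.map_map_of_aemeasurable (by fun_prop) (hX.prodMk (hY.prodMk hZ))]
  rfl

end MutualInformation

/-! ### Joint density of an additive noise channel. -/

section AdditiveNoise

variable {Ω G : Type*} [MeasurableSpace Ω] {P : Measure Ω} [IsProbabilityMeasure P]
  [AddCommGroup G] [MeasurableSpace G] [MeasurableAdd₂ G] [MeasurableSub₂ G]

/-- The joint law of an input `X` and the output `X + V` of an additive noise channel has density
`p (t - x) / r t` with respect to the product of the marginal laws, where `p` and `r` are the
densities of the noise and of the output. -/
lemma map_add_prodMk_eq_withDensity {m : Measure G} [SigmaFinite m] [m.IsAddLeftInvariant]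
    {X V : Ω → G} (hX : AEMeasurable X P) (hV : AEMeasurable V P) (hXV : IndepFun X V P)
    {p r : G → ℝ≥0∞} (hp : Measurable p) (hr : Measurable r)
    (hr0 : ∀ t, r t ≠ 0) (hrtop : ∀ t, r t ≠ ∞)
    (hVp : P.map V = m.withDensity p) (hTr : P.map (fun ω => X ω + V ω) = m.withDensity r) :
    P.map (fun ω => (X ω + V ω, X ω)) =
      ((P.map fun ω => X ω + V ω).prod (P.map X)).withDensity
        fun z => p (z.1 - z.2) / r z.1 := by
  have := Measure.isProbabilityMeasure_map hX
  have := Measure.isProbabilityMeasure_map hV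
  have := Measure.isProbabilityMeasure_map (hX.add hV)
  have hjoint := (indepFun_iff_map_prod_eq_prod_map_map hX hV).1 hXV
  let k : G × G → G × G := fun z => (z.1 + z.2, z.1)
  have hk : Measurable k := by fun_prop
  have hl : P.map (fun ω => (X ω + V ω, X ω)) = ((P.map X).prod (P.map V)).map k := by
    rw [← hjoint, AEMeasurable.map_map_of_aemeasurable hk.aemeasurable (hX.prodMk hV)]
    rfl
  have hd : Measurable fun z : G × G => p (z.1 - z.2) / r z.1 := by fun_prop
  refine Measure.ext_of_lintegral _ fun φ hφ => ?_
  rw [hl, lintegral_map hφ hk, lintegral_prod _ (by fun_prop),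
    lintegral_withDensity_eq_lintegral_mul _ hd hφ, lintegral_prod_symm _ (by fun_prop)]
  refine lintegral_congr fun x => ?_
  -- For fixed input `x`, left invariance of `m` allows the substitution `t = x + v` in the output
  -- integral; the factor `r` then cancels.
  rw [hVp, hTr, lintegral_withDensity_eq_lintegral_mul _ hp (by fun_prop),
    lintegral_withDensity_eq_lintegral_mul _ hr (by fun_prop),
    ← lintegral_add_left_eq_self (μ := m)
      (r * ((fun z : G × G => p (z.1 - z.2) / r z.1) * φ <| ⟨·, x⟩)) x]
  refine lintegral_congr fun v => ?_
  simp only [Pi.mul_apply, k, add_sub_cancel_left]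
  rw [← mul_assoc, ENNReal.mul_div_cancel (hr0 _) (hrtop _)]

end AdditiveNoise

/-! ### Scalar circular Gaussians and the scalar channel. -/

section ComplexGaussian

variable {Ω : Type*} [MeasurableSpace Ω] {P : Measure Ω}

lemma isScalarCSCG_iff {b : Ω → ℂ} {α : ℝ} :
    IsScalarCSCG b α P ↔ HasGaussianLaw b P ∧ ∫ ω, b ω ∂P = 0 ∧
      ∫ ω, b ω * star (b ω) ∂P = α ∧ ∫ ω, b ω * b ω ∂P = 0 := by
  constructor
  · intro h
    refine ⟨HasGaussianLaw.eval (X := fun _ : Fin 1 => b) h.hasGaussianLaw 0, h.mean_eq 0, ?_,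
      h.pseudoCovariance_eq 0 0⟩
    exact congrFun (congrFun h.covariance_eq 0) 0
  · rintro ⟨h1, h2, h3, h4⟩
    refine ⟨h1.map_fun (ContinuousLinearMap.pi fun _ : Fin 1 => .id ℝ ℂ), fun _ => h2, ?_,
      fun _ _ => h4⟩
    ext i j
    exact h3

/-- The density of the circularly symmetric complex Gaussian law with variance `v`. -/
noncomputable def complexGaussianPDFReal (v : ℝ) (z : ℂ) : ℝ :=
  (Real.pi * v)⁻¹ * Real.exp (-‖z‖ ^ 2 / v)

lemma complexGaussianPDFReal_pos {v : ℝ} (hv : 0 < v) (z : ℂ) :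
    0 < complexGaussianPDFReal v z := by
  have := Real.pi_pos
  unfold complexGaussianPDFReal
  positivity

lemma measurable_complexGaussianPDFReal (v : ℝ) : Measurable (complexGaussianPDFReal v) := by
  unfold complexGaussianPDFReal
  fun_prop

namespace IsScalarCSCG

variable {b : Ω → ℂ} {α : ℝ}

lemma gaussianLaw (h : IsScalarCSCG b α P) : HasGaussianLaw b P := (isScalarCSCG_iff.1 h).1

lemma integral_normSq (h : IsScalarCSCG b α P) : ∫ ω, ‖b ω‖ ^ 2 ∂P = α := by
  have h3 := (isScalarCSCG_iff.1 h).2.2.1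
  have : ∀ ω, b ω * star (b ω) = ((‖b ω‖ ^ 2 : ℝ) : ℂ) := fun ω => by
    simp [Complex.mul_conj, Complex.normSq_eq_norm_sq]
  simp_rw [this, integral_complex_ofReal] at h3
  exact_mod_cast h3

lemma integrable_normSq (h : IsScalarCSCG b α P) : Integrable (fun ω => ‖b ω‖ ^ 2) P :=
  h.gaussianLaw.memLp_two.integrable_norm_pow two_ne_zero

lemma hasGaussianLaw_re_im (h : IsScalarCSCG b α P) :
    HasGaussianLaw (fun ω => ((b ω).re, (b ω).im)) P :=
  h.gaussianLaw.map_equiv Complex.equivRealProdCLM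

/-- `E|b|² = α` gives the sum of the two real second moments; the real and imaginary parts of `E b²
= 0` give their equality and the vanishing of the mixed moment. -/
lemma integral_re_im (h : IsScalarCSCG b α P) :
    (∫ ω, (b ω).re ∂P = 0) ∧ (∫ ω, (b ω).im ∂P = 0) ∧ (∫ ω, (b ω).re ^ 2 ∂P = α / 2) ∧
      (∫ ω, (b ω).im ^ 2 ∂P = α / 2) ∧ ∫ ω, (b ω).re * (b ω).im ∂P = 0 := by
  obtain ⟨hG, h0, -, hp⟩ := isScalarCSCG_iff.1 h
  have hre := h.hasGaussianLaw_re_im.fst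
  have him := h.hasGaussianLaw_re_im.snd
  have hbb : Integrable (fun ω => b ω * b ω) P := hG.memLp_two.integrable_mul hG.memLp_two
  have hr2 : Integrable (fun ω => (b ω).re ^ 2) P := hre.memLp_two.integrable_sq
  have hi2 : Integrable (fun ω => (b ω).im ^ 2) P := him.memLp_two.integrable_sq
  have e1 : ∫ ω, (b ω).re ^ 2 ∂P + ∫ ω, (b ω).im ^ 2 ∂P = α := by
    rw [← h.integral_normSq, ← integral_add hr2 hi2]
    refine integral_congr_ae (.of_forall fun ω => ?_)
    simp only [← Complex.normSq_eq_norm_sq, Complex.normSq_apply]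
    ring
  have e2 : ∫ ω, (b ω).re ^ 2 ∂P - ∫ ω, (b ω).im ^ 2 ∂P = 0 := by
    rw [← integral_sub hr2 hi2]
    have := integral_re hbb
    simp only [hp, RCLike.re_to_complex, Complex.zero_re, Complex.mul_re] at this
    rw [← this]
    refine integral_congr_ae (.of_forall fun ω => ?_)
    simp only
    ring
  have e3 : 2 * ∫ ω, (b ω).re * (b ω).im ∂P = 0 := by
    rw [← integral_const_mul]
    have := integral_im hbb
    simp only [hp, RCLike.im_to_complex, Complex.zero_im, Complex.mul_im] at this
    rw [← this]
    refine integral_congr_ae (.of_forall fun ω => ?_)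
    simp only
    ring
  refine ⟨?_, ?_, by linarith, by linarith, by linarith⟩
  · simpa [h0] using integral_re hG.integrable
  · simpa [h0] using integral_im hG.integrable

lemma nonneg (h : IsScalarCSCG b α P) : 0 ≤ α := by
  rw [← h.integral_normSq]
  exact integral_nonneg fun ω => by positivity

/-- The real and imaginary parts are jointly Gaussian and uncorrelated, hence independent, and each
carries half the variance. -/
lemma map_re_im (h : IsScalarCSCG b α P) :
    P.map (fun ω => ((b ω).re, (b ω).im)) =
      (gaussianReal 0 (α / 2).toNNReal).prod (gaussianReal 0 (α / 2).toNNReal) := by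
  have := h.gaussianLaw.isProbabilityMeasure
  have hre := h.hasGaussianLaw_re_im.fst
  have him := h.hasGaussianLaw_re_im.snd
  obtain ⟨hr, hi, hr2, hi2, hri⟩ := h.integral_re_im
  have hind : IndepFun (fun ω => (b ω).re) (fun ω => (b ω).im) P := by
    refine h.hasGaussianLaw_re_im.indepFun_of_covariance_eq_zero ?_
    rw [covariance_eq_sub hre.memLp_two him.memLp_two, hr, hi]
    simpa using hri
  rw [(indepFun_iff_map_prod_eq_prod_map_map hre.aemeasurable him.aemeasurable).1 hind,
    hre.map_eq_gaussianReal, him.map_eq_gaussianReal, hr, hi,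
    variance_of_integral_eq_zero hre.aemeasurable hr,
    variance_of_integral_eq_zero him.aemeasurable hi, hr2, hi2]

/-- A circularly symmetric complex Gaussian law with positive variance has the usual density. -/
lemma map_eq_withDensity (h : IsScalarCSCG b α P) (hα : 0 < α) :
    P.map b = volume.withDensity fun z => ENNReal.ofReal (complexGaussianPDFReal α z) := by
  have hv : (α / 2).toNNReal ≠ 0 := by simpa using hα
  have hmap : P.map b = (P.map fun ω => ((b ω).re, (b ω).im)).map
      Complex.measurableEquivRealProd.symm := by
    rw [AEMeasurable.map_map_of_aemeasurable (by fun_prop) h.hasGaussianLaw_re_im.aemeasurable]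
    rfl
  rw [hmap, h.map_re_im, gaussianReal_of_var_ne_zero _ hv,
    prod_withDensity (by fun_prop) (by fun_prop)]
  refine Measure.ext_of_lintegral _ fun φ hφ => ?_
  have hm := measurable_complexGaussianPDFReal α
  rw [lintegral_map hφ (by fun_prop),
    lintegral_withDensity_eq_lintegral_mul _ (by fun_prop) (by fun_prop),
    lintegral_withDensity_eq_lintegral_mul _ (by fun_prop) hφ,
    Complex.volume_preserving_equiv_real_prod.symm.lintegral_map_equiv, ← Measure.volume_eq_prod]
  refine lintegral_congr fun z => ?_
  simp only [Pi.mul_apply]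
  congr 1
  rw [gaussianPDF, gaussianPDF, ← ENNReal.ofReal_mul (gaussianPDFReal_nonneg _ _ _)]
  congr 1
  simp only [gaussianPDFReal, complexGaussianPDFReal, ← Complex.normSq_eq_norm_sq,
    Complex.normSq_apply, Real.coe_toNNReal _ (by positivity : 0 ≤ α / 2)]
  have e : 2 * Real.pi * (α / 2) = Real.pi * α := by ring
  rw [e, mul_mul_mul_comm, ← Real.exp_add, ← mul_inv, Real.mul_self_sqrt (by positivity)]
  congr 2
  simp only [Complex.measurableEquivRealProd_symm_apply]
  field_simp
  ring

end IsScalarCSCG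

/-- The sum of independent circularly symmetric complex Gaussians. -/
lemma IsScalarCSCG.add {b V : Ω → ℂ} {α v : ℝ} (hb : IsScalarCSCG b α P)
    (hV : IsScalarCSCG V v P) (hbV : IndepFun b V P) :
    IsScalarCSCG (fun ω => b ω + V ω) (α + v) P := by
  obtain ⟨bG, b0, b1, b2⟩ := isScalarCSCG_iff.1 hb
  obtain ⟨vG, v0, v1, v2⟩ := isScalarCSCG_iff.1 hV
  have mb := bG.memLp_two
  have mv := vG.memLp_two
  have hstar : ∀ {f : Ω → ℂ}, MemLp f 2 P → MemLp (fun ω => star (f ω)) 2 P := fun hf => hf.star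
  have c1 : ∫ ω, b ω * V ω ∂P = 0 := by
    rw [hbV.integral_fun_mul_eq_mul_integral mb.1 mv.1, b0, zero_mul]
  have c2 : ∫ ω, b ω * star (V ω) ∂P = 0 := by
    have : IndepFun b (fun ω => star (V ω)) P := hbV.comp measurable_id continuous_star.measurable
    rw [this.integral_fun_mul_eq_mul_integral mb.1 (hstar mv).1, b0, zero_mul]
  have c3 : ∫ ω, V ω * star (b ω) ∂P = 0 := by
    have : IndepFun V (fun ω => star (b ω)) P := hbV.symm.comp measurable_id continuous_star.measurable
    rw [this.integral_fun_mul_eq_mul_integral mv.1 (hstar mb).1, v0, zero_mul]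
  refine isScalarCSCG_iff.2 ⟨(hbV.hasGaussianLaw bG vG).fun_add, ?_, ?_, ?_⟩
  · rw [integral_add bG.integrable vG.integrable, b0, v0, add_zero]
  · have i1 : Integrable (fun ω => b ω * star (b ω)) P := mb.integrable_mul (hstar mb)
    have i2 : Integrable (fun ω => V ω * star (V ω)) P := mv.integrable_mul (hstar mv)
    have i3 : Integrable (fun ω => b ω * star (V ω)) P := mb.integrable_mul (hstar mv)
    have i4 : Integrable (fun ω => V ω * star (b ω)) P := mv.integrable_mul (hstar mb)
    simp_rw [star_add, mul_add, add_mul]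
    rw [integral_add (i1.fun_add i4) (i3.fun_add i2), integral_add i1 i4, integral_add i3 i2, b1, c3, c2,
      v1]
    push_cast
    ring
  · have i1 : Integrable (fun ω => b ω * b ω) P := mb.integrable_mul mb
    have i2 : Integrable (fun ω => V ω * V ω) P := mv.integrable_mul mv
    have i3 : Integrable (fun ω => b ω * V ω) P := mb.integrable_mul mv
    have i4 : Integrable (fun ω => V ω * b ω) P := mv.integrable_mul mb
    simp_rw [mul_add, add_mul]
    rw [integral_add (i1.fun_add i4) (i3.fun_add i2), integral_add i1 i4, integral_add i3 i2, b2, c1, v2]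
    simp_rw [mul_comm (V _) (b _), c1]
    simp

/-- The mutual information between input and output of a scalar complex Gaussian channel. -/
lemma mutualInfo_add_eq_log [IsProbabilityMeasure P] {b V : Ω → ℂ} {α v : ℝ}
    (hb : IsScalarCSCG b α P) (hV : IsScalarCSCG V v P) (hbV : IndepFun b V P) (hv : 0 < v) :
    mutualInfo (fun ω => b ω + V ω) b P = ENNReal.ofReal (Real.log (1 + α / v)) := by
  have hα := hb.nonneg
  have hT := hb.add hV hbV
  have hs : 0 < α + v := by positivity
  have mb := hb.gaussianLaw.aemeasurable
  have mV := hV.gaussianLaw.aemeasurable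
  have mT := hT.gaussianLaw.aemeasurable
  have := Measure.isProbabilityMeasure_map mb
  have := Measure.isProbabilityMeasure_map mT
  have := Measure.isProbabilityMeasure_map (mT.prodMk mb)
  have hpm := measurable_complexGaussianPDFReal v
  have hrm := measurable_complexGaussianPDFReal (α + v)
  have hdens := map_add_prodMk_eq_withDensity mb mV hbV (m := volume)
    (p := fun z => ENNReal.ofReal (complexGaussianPDFReal v z))
    (r := fun z => ENNReal.ofReal (complexGaussianPDFReal (α + v) z))
    (by fun_prop) (by fun_prop)
    (fun t => by simpa using complexGaussianPDFReal_pos hs t) (fun t => by simp)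
    (hV.map_eq_withDensity hv) (hT.map_eq_withDensity hs)
  set μ := P.map (fun ω => (b ω + V ω, b ω)) with hμ
  set ν := (P.map fun ω => b ω + V ω).prod (P.map b) with hν
  have hac : μ ≪ ν := by rw [hdens]; exact withDensity_absolutelyContinuous _ _
  -- The logarithm of the density ratio `p (t - x) / r t`, with the factors `π` cancelled.
  let g : ℂ × ℂ → ℝ := fun z =>
    Real.log (1 + α / v) - ‖z.1 - z.2‖ ^ 2 / v + ‖z.1‖ ^ 2 / (α + v)
  have hllr : llr μ ν =ᵐ[μ] g := by
    -- The Radon–Nikodym derivative is identified `ν`-almost everywhere; absolute continuity carries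
    -- this over to `μ`.
    refine hac.ae_le ?_
    have h1 := Measure.rnDeriv_withDensity ν
      (f := fun z : ℂ × ℂ => ENNReal.ofReal (complexGaussianPDFReal v (z.1 - z.2)) /
        ENNReal.ofReal (complexGaussianPDFReal (α + v) z.1)) (by fun_prop)
    rw [← hdens] at h1
    filter_upwards [h1] with z hz
    have hp1 := complexGaussianPDFReal_pos hv (z.1 - z.2)
    have hr1 := complexGaussianPDFReal_pos hs z.1
    have hpi := Real.pi_pos
    rw [llr, hz, ← ENNReal.ofReal_div_of_pos hr1, ENNReal.toReal_ofReal (by positivity),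
      Real.log_div hp1.ne' hr1.ne']
    simp only [complexGaussianPDFReal, g]
    rw [Real.log_mul (by positivity) (by positivity), Real.log_mul (by positivity) (by positivity),
      Real.log_exp, Real.log_exp, Real.log_inv, Real.log_inv, Real.log_mul hpi.ne' hv.ne',
      Real.log_mul hpi.ne' hs.ne', show 1 + α / v = (α + v) / v by field_simp; ring,
      Real.log_div hs.ne' hv.ne']
    ring
  have hgm : Measurable g := by fun_prop
  have hcomp : ∀ ω, g (b ω + V ω, b ω) =
      Real.log (1 + α / v) - ‖V ω‖ ^ 2 / v + ‖b ω + V ω‖ ^ 2 / (α + v) := fun ω => by simp [g]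
  have hi1 : Integrable (fun ω => ‖V ω‖ ^ 2 / v) P := hV.integrable_normSq.div_const v
  have hi2 : Integrable (fun ω => ‖b ω + V ω‖ ^ 2 / (α + v)) P :=
    hT.integrable_normSq.div_const _
  have hi0 : Integrable (fun _ : Ω => Real.log (1 + α / v)) P := integrable_const _
  have hgint : Integrable g μ := by
    rw [hμ, integrable_map_measure hgm.aestronglyMeasurable (mT.prodMk mb)]
    exact ((hi0.sub hi1).add hi2).congr (.of_forall fun ω => (hcomp ω).symm)
  have hgval : ∫ z, g z ∂μ = Real.log (1 + α / v) := by
    rw [hμ, integral_map (mT.prodMk mb) hgm.aestronglyMeasurable]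
    simp_rw [hcomp]
    -- Both normalized quadratic terms have expectation 1 and cancel, which leaves the constant.
    rw [integral_add (by fun_prop) hi2, integral_sub hi0 hi1, integral_div, integral_div,
      hV.integral_normSq, hT.integral_normSq, div_self hv.ne', div_self hs.ne']
    simp
  rw [mutualInfo, klDiv_of_ac_of_integrable hac ((integrable_congr hllr).2 hgint),
    integral_congr_ae hllr, hgval]
  simp

end ComplexGaussian

/-! ### Reduction of the vector channel to the scalar one. -/

section VectorGaussian

variable {Ω ι : Type*} [MeasurableSpace Ω] [Fintype ι] {P : Measure Ω}

lemma integrable_mul_of_memLp_two {f g : Ω → ℂ} (hf : MemLp f 2 P) (hg : MemLp g 2 P) :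
    Integrable (fun ω => f ω * g ω) P :=
  hf.integrable_mul hg

lemma integrable_mul_star_of_memLp_two {f g : Ω → ℂ} (hf : MemLp f 2 P) (hg : MemLp g 2 P) :
    Integrable (fun ω => f ω * star (g ω)) P :=
  hf.integrable_mul hg.star

/-- A real-linear functional on `ι → ℂ` is the real part of a complex-linear one. -/
lemma exists_eq_re_sum_mul [DecidableEq ι] (l : StrongDual ℝ (ι → ℂ)) :
    ∃ u : ι → ℂ, ∀ z, l z = (∑ i, u i * z i).re := by
  -- With `p = l(e_i)` and `r = l(i e_i)`, `Re ((p - i r)(x + i y)) = p x + r y`.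
  refine ⟨fun i => l (Pi.single i 1) - l (Pi.single i Complex.I) * Complex.I, fun z => ?_⟩
  have hz : z = ∑ i, ((z i).re • (Pi.single i 1 : ι → ℂ) +
      (z i).im • (Pi.single i Complex.I : ι → ℂ)) := by
    ext j
    simp [Finset.sum_apply, Pi.single_apply, Finset.sum_add_distrib, Complex.re_add_im]
  conv_lhs => rw [hz]
  simp only [map_sum, map_add, map_smul, smul_eq_mul, Complex.re_sum]
  refine Finset.sum_congr rfl fun i _ => ?_
  simp
  ring

/-- Jointly Gaussian complex vectors with mean zero whose cross-covariance and cross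
pseudo-covariance vanish are independent. -/
lemma indepFun_of_crossMoment_eq_zero {κ : Type*} [Fintype κ]
    {X : Ω → ι → ℂ} {Y : Ω → κ → ℂ} (hXY : HasGaussianLaw (fun ω => (X ω, Y ω)) P)
    (hX0 : ∀ i, ∫ ω, X ω i ∂P = 0)
    (h1 : ∀ i k, ∫ ω, X ω i * Y ω k ∂P = 0)
    (h2 : ∀ i k, ∫ ω, X ω i * star (Y ω k) ∂P = 0) : IndepFun X Y P := by
  classical
  have := hXY.isProbabilityMeasure
  have hXi : ∀ i, HasGaussianLaw (fun ω => X ω i) P := fun i =>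
    HasGaussianLaw.eval (X := fun i ω => X ω i) hXY.fst i
  have hYi : ∀ i, HasGaussianLaw (fun ω => Y ω i) P := fun i =>
    HasGaussianLaw.eval (X := fun i ω => Y ω i) hXY.snd i
  refine hXY.indepFun_of_covariance_strongDual fun l₁ l₂ => ?_
  obtain ⟨u, hu⟩ := exists_eq_re_sum_mul l₁
  obtain ⟨w, hw⟩ := exists_eq_re_sum_mul l₂
  rw [covariance_eq_sub (hXY.fst.map l₁).memLp_two (hXY.snd.map l₂).memLp_two]
  have hiX : ∀ i, Integrable (fun ω => u i * X ω i) P := fun i => (hXi i).integrable.const_mul _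
  have e0 : ∫ ω, (l₁ ∘ X) ω ∂P = 0 := by
    have h := integral_re (integrable_finsetSum Finset.univ fun i _ => hiX i)
    simp only [Function.comp_apply, hu]
    refine h.trans ?_
    rw [integral_finsetSum _ fun i _ => hiX i]
    simp [integral_const_mul, hX0]
  have iXY : ∀ i k, Integrable (fun ω => X ω i * Y ω k) P := fun i k =>
    (hXi i).memLp_two.integrable_mul (hYi k).memLp_two
  have iXY' : ∀ i k, Integrable (fun ω => X ω i * star (Y ω k)) P := fun i k =>
    (hXi i).memLp_two.integrable_mul (hYi k).memLp_two.star
  have hi : ∀ i k, Integrable (fun ω => u i * w k * (X ω i * Y ω k) +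
      u i * star (w k) * (X ω i * star (Y ω k))) P := fun i k =>
    ((iXY i k).const_mul _).fun_add ((iXY' i k).const_mul _)
  -- The identity `Re A · Re B = ½ Re (A (B + B̄))` expresses the real covariance through the
  -- cross-moments with `Y` and with its conjugate.
  have hprod : ∀ ω, (l₁ ∘ X * l₂ ∘ Y) ω = 2⁻¹ * (∑ i, ∑ k, (u i * w k * (X ω i * Y ω k) +
      u i * star (w k) * (X ω i * star (Y ω k)))).re := fun ω => by
    have : ∑ i, ∑ k, (u i * w k * (X ω i * Y ω k) +
        u i * star (w k) * (X ω i * star (Y ω k))) =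
        (∑ i, u i * X ω i) * ((∑ k, w k * Y ω k) + star (∑ k, w k * Y ω k)) := by
      rw [star_sum, ← Finset.sum_add_distrib, Finset.sum_mul_sum]
      refine Finset.sum_congr rfl fun i _ => Finset.sum_congr rfl fun k _ => ?_
      rw [star_mul']
      ring
    rw [this]
    simp only [Pi.mul_apply, Function.comp_apply, hu, hw, Complex.mul_re, Complex.add_re,
      Complex.add_im, Complex.star_def, Complex.conj_re, Complex.conj_im]
    ring
  have e1 : ∫ ω, (l₁ ∘ X * l₂ ∘ Y) ω ∂P = 0 := by
    simp_rw [hprod]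
    rw [integral_const_mul]
    have hint : ∀ i ∈ Finset.univ, Integrable (fun ω => ∑ k, (u i * w k * (X ω i * Y ω k) +
        u i * star (w k) * (X ω i * star (Y ω k)))) P := fun i _ =>
      integrable_finsetSum _ fun k _ => hi i k
    have h := integral_re (integrable_finsetSum Finset.univ hint)
    refine mul_eq_zero_of_right _ (h.trans ?_)
    rw [integral_finsetSum _ hint]
    simp_rw [integral_finsetSum _ fun k _ => hi _ k,
      integral_add ((iXY _ _).const_mul _) ((iXY' _ _).const_mul _), integral_const_mul, h1, h2]
    simp
  rw [e0, e1, zero_mul, sub_zero]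

/-- The second moments of a complex-linear functional of a circularly symmetric complex Gaussian
vector. -/
lemma IsCSCG.dotProduct_moments {Z : Ω → ι → ℂ} {R : Matrix ι ι ℂ} (hZ : IsCSCG Z R P) (c : ι → ℂ) :
    HasGaussianLaw (fun ω => c ⬝ᵥ Z ω) P ∧ (∫ ω, c ⬝ᵥ Z ω ∂P = 0) ∧
      (∀ k, ∫ ω, (c ⬝ᵥ Z ω) * Z ω k ∂P = 0) ∧
      ∀ k, ∫ ω, (c ⬝ᵥ Z ω) * star (Z ω k) ∂P = (Matrix.vecMul c R) k := by
  have hi : ∀ i, HasGaussianLaw (fun ω => Z ω i) P := fun i =>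
    HasGaussianLaw.eval (X := fun i ω => Z ω i) hZ.hasGaussianLaw i
  refine ⟨?_, ?_, fun k => ?_, fun k => ?_⟩
  · let l : (ι → ℂ) →L[ℝ] ℂ := ∑ i, (ContinuousLinearMap.mul ℝ ℂ (c i)).comp (.proj i)
    have hl : (fun ω => c ⬝ᵥ Z ω) = fun ω => l (Z ω) := by
      ext ω
      simp [l, dotProduct]
    rw [hl]
    exact hZ.hasGaussianLaw.map_fun l
  · simp_rw [dotProduct]
    rw [integral_finsetSum _ fun i _ => (hi i).integrable.const_mul _]
    simp [integral_const_mul, hZ.mean_eq]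
  · simp_rw [dotProduct, Finset.sum_mul, mul_assoc]
    rw [integral_finsetSum _ fun i _ =>
      (integrable_mul_of_memLp_two (hi i).memLp_two (hi k).memLp_two).const_mul _]
    simp [integral_const_mul, hZ.pseudoCovariance_eq]
  · simp_rw [dotProduct, Finset.sum_mul, mul_assoc]
    rw [integral_finsetSum _ fun i _ =>
      (integrable_mul_star_of_memLp_two (hi i).memLp_two (hi k).memLp_two).const_mul _]
    simp_rw [integral_const_mul, Matrix.vecMul, dotProduct, ← hZ.covariance_eq]
    rfl

/-- The mutual information of the vector channel `y = b a + Z` with Gaussian input `b` and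
Gaussian noise `Z` of covariance `R`. The vector `c` is the whitened matched filter, and `q` is
the value of `aᴴ R⁻¹ a`. -/
lemma mutualInfo_smul_add_eq_log [IsProbabilityMeasure P] {b : Ω → ℂ} {α : ℝ}
    (hb : IsScalarCSCG b α P) {Z : Ω → ι → ℂ} {R : Matrix ι ι ℂ} (hZ : IsCSCG Z R P)
    (hbZ : IndepFun b Z P) {a c : ι → ℂ} {q : ℝ} (hq : 0 < q) (hca : c ⬝ᵥ a = 1)
    (hcR : ∀ k, (Matrix.vecMul c R) k = (q : ℂ)⁻¹ * star (a k)) :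
    mutualInfo (fun ω => b ω • a + Z ω) b P = ENNReal.ofReal (Real.log (1 + α * q)) := by
  obtain ⟨hVG, hV0, hVZ, hVZ'⟩ := hZ.dotProduct_moments c
  have hi : ∀ i, HasGaussianLaw (fun ω => Z ω i) P := fun i =>
    HasGaussianLaw.eval (X := fun i ω => Z ω i) hZ.hasGaussianLaw i
  set V : Ω → ℂ := fun ω => c ⬝ᵥ Z ω with hVdef
  replace hVZ : ∀ k, ∫ ω, V ω * Z ω k ∂P = 0 := hVZ
  replace hVZ' : ∀ k, ∫ ω, V ω * star (Z ω k) ∂P = (Matrix.vecMul c R) k := hVZ'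
  have hVV : ∫ ω, V ω * V ω ∂P = 0 := by
    have : ∀ ω, V ω * V ω = ∑ i, c i * (V ω * Z ω i) := fun ω => by
      conv_lhs => rhs; rw [hVdef]
      simp only [dotProduct, Finset.mul_sum]
      exact Finset.sum_congr rfl fun i _ => by ring
    simp_rw [this]
    rw [integral_finsetSum _ fun i _ =>
      (integrable_mul_of_memLp_two hVG.memLp_two (hi i).memLp_two).const_mul _]
    simp [integral_const_mul, hVZ]
  -- The variance is `c R cᴴ = q⁻¹ aᴴ cᴴ`, and `c a = 1` turns this into `q⁻¹`.
  have hVV' : ∫ ω, V ω * star (V ω) ∂P = (q⁻¹ : ℝ) := by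
    have : ∀ ω, V ω * star (V ω) = ∑ i, star (c i) * (V ω * star (Z ω i)) := fun ω => by
      conv_lhs => rhs; rw [hVdef]
      simp only [dotProduct, star_sum, Finset.mul_sum, star_mul']
      exact Finset.sum_congr rfl fun i _ => by ring
    simp_rw [this]
    rw [integral_finsetSum _ fun i _ =>
      (integrable_mul_star_of_memLp_two hVG.memLp_two (hi i).memLp_two).const_mul _]
    simp_rw [integral_const_mul, hVZ', hcR]
    have h := congrArg star hca
    simp only [dotProduct, star_sum, star_mul', star_one] at h
    calc ∑ i, star (c i) * ((q : ℂ)⁻¹ * star (a i))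
        = (q : ℂ)⁻¹ * ∑ i, star (c i) * star (a i) := by
          rw [Finset.mul_sum]
          exact Finset.sum_congr rfl fun i _ => by ring
      _ = _ := by rw [h]; simp
  have hV : IsScalarCSCG V q⁻¹ P := isScalarCSCG_iff.2 ⟨hVG, hV0, hVV', hVV⟩
  -- The part of the noise left after removing the matched filter output; `E V W̄ = q⁻¹ ā - q⁻¹ ā =
  -- 0`.
  let W : Ω → ι → ℂ := fun ω => Z ω - V ω • a
  have mb := hb.gaussianLaw.aemeasurable
  have mZ := hZ.hasGaussianLaw.aemeasurable
  have mV := hVG.aemeasurable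
  have mVW : Measurable fun z : ι → ℂ => (c ⬝ᵥ z, z - (c ⬝ᵥ z) • a) := by
    unfold dotProduct
    fun_prop
  have mW : AEMeasurable W P := (measurable_snd.comp mVW).comp_aemeasurable mZ
  have hVW : IndepFun V W P := by
    let l : (ι → ℂ) →L[ℝ] ℂ := ∑ i, (ContinuousLinearMap.mul ℝ ℂ (c i)).comp (.proj i)
    let l₁ : (ι → ℂ) →L[ℝ] (Fin 1 → ℂ) := .pi fun _ => l
    let l₂ : (ι → ℂ) →L[ℝ] (ι → ℂ) :=
      .pi fun k => .proj k - (ContinuousLinearMap.mul ℝ ℂ (a k)).comp l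
    have hl : ∀ z, l z = c ⬝ᵥ z := fun z => by simp [l, dotProduct]
    have hG : HasGaussianLaw (fun ω => ((fun _ : Fin 1 => V ω), W ω)) P := by
      have := hZ.hasGaussianLaw.map_fun (l₁.prod l₂)
      convert! this using 2 with ω
      refine Prod.ext ?_ ?_
      · ext i
        simp [l₁, hl, V]
      · ext k
        simp [l₂, hl, V, W, mul_comm]
    have h := indepFun_of_crossMoment_eq_zero hG (fun _ => hV0) (fun _ k => ?_) (fun _ k => ?_)
    · exact h.comp (measurable_pi_apply 0) measurable_id
    · have : ∀ ω, V ω * W ω k = V ω * Z ω k - V ω * V ω * a k := fun ω => by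
        simp [W]
        ring
      simp_rw [this]
      rw [integral_sub (integrable_mul_of_memLp_two hVG.memLp_two (hi k).memLp_two)
        ((integrable_mul_of_memLp_two hVG.memLp_two hVG.memLp_two).mul_const _), integral_mul_const, hVZ, hVV]
      simp
    · have : ∀ ω, V ω * star (W ω k) = V ω * star (Z ω k) - V ω * star (V ω) * star (a k) :=
        fun ω => by
          simp [W]
          ring
      simp_rw [this]
      rw [integral_sub (integrable_mul_star_of_memLp_two hVG.memLp_two (hi k).memLp_two)
        ((integrable_mul_star_of_memLp_two hVG.memLp_two hVG.memLp_two).mul_const _), integral_mul_const,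
        hVZ', hVV', hcR]
      simp
  have hbVW : IndepFun b (fun ω => (V ω, W ω)) P := hbZ.comp measurable_id mVW
  have hbV : IndepFun b V P := hbVW.comp measurable_id measurable_fst
  have hind := indepFun_prodMk_of_indepFun mb mV mW hbVW hVW
  have hTW : IndepFun (fun ω => (b ω + V ω, b ω)) W P :=
    hind.comp (φ := fun z : ℂ × ℂ => (z.1 + z.2, z.1)) (by fun_prop) measurable_id
  have hscalar := mutualInfo_add_eq_log hb hV hbV (inv_pos.2 hq)
  rw [div_inv_eq_mul] at hscalar
  rw [← hscalar]
  -- Upper bound: the observation is `(b + V) a + W`, with `W` independent of `(b + V, b)`. Lower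
  -- bound: applying `c` to the observation returns `b + V`.
  refine le_antisymm ?_ ?_
  · have h := mutualInfo_comp_indep_le (mb.add mV) mb mW hTW
      (g := fun z : ℂ × (ι → ℂ) => z.1 • a + z.2) (by fun_prop)
    convert! h using 2
    ext ω i
    simp [W]
    ring
  · have mY : AEMeasurable (fun ω => b ω • a + Z ω) P := by fun_prop
    have h := mutualInfo_comp_le mY mb (f := fun z : ι → ℂ => c ⬝ᵥ z)
      (measurable_fst.comp mVW)
    convert! h using 2
    ext ω
    rw [dotProduct_add, dotProduct_smul, hca]
    simp [V]

end VectorGaussian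

/-! ### The uplink model: noise covariance, matched filter and gain. -/

section Uplink

variable {N L : ℕ}

open scoped Kronecker in
/-- The covariance matrix of the interference plus noise. -/
lemma secondMoment_interferencePlusNoise {Ω : Type*} [MeasurableSpace Ω] {P : Measure Ω}
    [IsProbabilityMeasure P] {pc : ℝ} (hpc : 0 ≤ pc) (hc : EuclideanSpace ℂ (Fin N))
    {sc : Ω → Fin L → ℂ} (hsc_meas : AEMeasurable sc P) (hsc : secondMoment sc P = 1)
    {Nu : Ω → Matrix (Fin N) (Fin L) ℂ} (hNu : IsCSCG (fun ω => (Nu ω).vec) 1 P)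
    (hscNu : IndepFun sc (fun ω => (Nu ω).vec) P) :
    secondMoment (fun ω => (interferencePlusNoise pc hc (sc ω) (Nu ω)).vec) P =
      (1 : Matrix (Fin L) (Fin L) ℂ) ⊗ₖ
        (1 + (pc : ℂ) • Matrix.vecMulVec hc.ofLp (star hc.ofLp)) := by
  have hscm : ∀ j, AEMeasurable (fun ω => sc ω j) P := fun j => hsc_meas.eval j
  have hsc' : ∀ j j', ∫ ω, sc ω j * star (sc ω j') ∂P = (1 : Matrix (Fin L) (Fin L) ℂ) j j' :=
    fun j j' => congrFun (congrFun hsc j) j'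
  have hscL : ∀ j, MemLp (fun ω => sc ω j) 2 P := fun j => by
    have hint : Integrable (fun ω => sc ω j * star (sc ω j)) P := by
      -- A non-integrable function has integral 0 by convention, whereas this diagonal entry is 1;
      -- so the second-moment hypothesis already forces square integrability.
      by_contra h
      have := hsc' j j
      rw [integral_undef h] at this
      simp at this
    refine (memLp_two_iff_integrable_sq_norm (hscm j).aestronglyMeasurable).2 ?_
    refine hint.norm.congr (.of_forall fun ω => ?_)
    simp [sq]
  have hN : ∀ k, HasGaussianLaw (fun ω => (Nu ω).vec k) P := fun k =>
    HasGaussianLaw.eval (X := fun k ω => (Nu ω).vec k) hNu.hasGaussianLaw k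
  have hNN : ∀ k k', ∫ ω, (Nu ω).vec k * star ((Nu ω).vec k') ∂P =
      (1 : Matrix (Fin L × Fin N) (Fin L × Fin N) ℂ) k k' :=
    fun k k' => congrFun (congrFun hNu.covariance_eq k) k'
  -- Only the noise needs mean zero here; `sc` need not be centred.
  have hcross : ∀ k j, ∫ ω, (Nu ω).vec k * sc ω j ∂P = 0 := fun k j => by
    have hi : IndepFun (fun ω => (Nu ω).vec k) (fun ω => sc ω j) P :=
      hscNu.symm.comp (measurable_pi_apply k) (measurable_pi_apply j)
    rw [hi.integral_fun_mul_eq_mul_integral (hN k).memLp_two.1 (hscL j).1, hNu.mean_eq, zero_mul]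
  have hcross' : ∀ j k, ∫ ω, star (sc ω j) * star ((Nu ω).vec k) ∂P = 0 := fun j k => by
    have h : ∀ ω, star (sc ω j) * star ((Nu ω).vec k) =
        (starRingEnd ℂ) ((Nu ω).vec k * sc ω j) := fun ω => by simp [mul_comm]
    simp_rw [h]
    rw [integral_conj, hcross, map_zero]
  have hsq : ((Real.sqrt pc : ℝ) : ℂ) * (Real.sqrt pc : ℝ) = pc := by
    rw [← Complex.ofReal_mul, Real.mul_self_sqrt hpc]
  ext ⟨j, i⟩ ⟨j', i'⟩
  have hexp : ∀ ω, (interferencePlusNoise pc hc (sc ω) (Nu ω)).vec (j, i) *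
      star ((interferencePlusNoise pc hc (sc ω) (Nu ω)).vec (j', i')) =
      (pc * hc i * star (hc i') * (sc ω j' * star (sc ω j)) +
        Real.sqrt pc * hc i * (star (sc ω j) * star ((Nu ω).vec (j', i')))) +
      (Real.sqrt pc * star (hc i') * ((Nu ω).vec (j, i) * sc ω j') +
        (Nu ω).vec (j, i) * star ((Nu ω).vec (j', i'))) := fun ω => by
    simp only [interferencePlusNoise, Matrix.vec, Matrix.add_apply, Matrix.smul_apply,
      Matrix.vecMulVec_apply, Pi.star_apply, smul_eq_mul, star_add, star_mul', star_star, ← hsq]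
    simp only [Complex.star_def, Complex.conj_ofReal]
    ring
  have i1 := (integrable_mul_star_of_memLp_two (hscL j') (hscL j)).const_mul
    (pc * hc i * star (hc i'))
  have i2 : Integrable (fun ω => Real.sqrt pc * hc i *
      (star (sc ω j) * star ((Nu ω).vec (j', i')))) P :=
    (integrable_mul_star_of_memLp_two (hscL j).star (hN (j', i')).memLp_two).const_mul _
  have i3 := (integrable_mul_of_memLp_two (hN (j, i)).memLp_two (hscL j')).const_mul
    (Real.sqrt pc * star (hc i'))
  have i4 := integrable_mul_star_of_memLp_two (hN (j, i)).memLp_two (hN (j', i')).memLp_two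
  rw [secondMoment, Matrix.of_apply]
  simp_rw [hexp]
  rw [integral_add (i1.fun_add i2) (i3.fun_add i4), integral_add i1 i2, integral_add i3 i4,
    integral_const_mul, integral_const_mul, integral_const_mul, hsc', hcross, hcross', hNN]
  simp only [Matrix.kroneckerMap_apply, Matrix.add_apply, Matrix.smul_apply,
    Matrix.vecMulVec_apply, Pi.star_apply, Matrix.one_apply, Prod.mk.injEq, smul_eq_mul]
  by_cases hj : j = j' <;> by_cases hi : i = i' <;> simp [hj, hi, eq_comm] <;> ring

/-- The steering vector of the vectorized echo. -/
noncomputable def echoVec (ps : ℝ) (hs w : EuclideanSpace ℂ (Fin N))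
    (ss : EuclideanSpace ℂ (Fin L)) : Fin L × Fin N → ℂ :=
  fun k => Real.sqrt ps * (hs.ofLp ⬝ᵥ w.ofLp) * hs k.2 * star (ss k.1)

lemma vec_echo_add (ps : ℝ) (hs w : EuclideanSpace ℂ (Fin N)) (ss : EuclideanSpace ℂ (Fin L))
    (b : ℂ) (Z : Matrix (Fin N) (Fin L) ℂ) :
    (echo ps hs w ss b + Z).vec = b • echoVec ps hs w ss + Z.vec := by
  ext ⟨j, i⟩
  simp only [echo, targetResponse, echoVec, Matrix.vec, Matrix.add_apply, Matrix.smul_apply,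
    Matrix.vecMulVec_apply, Pi.star_apply, smul_eq_mul, Pi.add_apply, Pi.smul_apply,
    Matrix.smul_mulVec, Matrix.vecMulVec_mulVec, MulOpposite.smul_eq_mul_unop,
    MulOpposite.unop_op]
  ring

/-- The value of `h_sᴴ (I + p_c h_c h_cᴴ)⁻¹ h_s`. -/
noncomputable def whitenedGain (pc : ℝ) (hc hs : EuclideanSpace ℂ (Fin N)) : ℝ :=
  ‖hs‖ ^ 2 - pc * ‖inner ℂ hs hc‖ ^ 2 / (1 + pc * ‖hc‖ ^ 2)

/-- By Cauchy–Schwarz the subtracted term is at most `‖h_s‖² · p_c‖h_c‖² / (1 + p_c‖h_c‖²)`, which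
is strictly less than `‖h_s‖²`. -/
lemma whitenedGain_pos {pc : ℝ} (hpc : 0 ≤ pc) (hc : EuclideanSpace ℂ (Fin N))
    {hs : EuclideanSpace ℂ (Fin N)} (hhs : hs ≠ 0) : 0 < whitenedGain pc hc hs := by
  have h1 : ‖inner ℂ hs hc‖ ^ 2 ≤ ‖hs‖ ^ 2 * ‖hc‖ ^ 2 := by
    rw [← mul_pow]
    gcongr
    exact norm_inner_le_norm hs hc
  have hn : 0 < ‖hs‖ ^ 2 := by positivity
  rw [whitenedGain, sub_pos, div_lt_iff₀ (by positivity)]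
  nlinarith [mul_le_mul_of_nonneg_left h1 hpc]

lemma sum_star_mul_eq_inner {n : ℕ} (x y : EuclideanSpace ℂ (Fin n)) :
    ∑ i, star (x i) * y i = inner ℂ x y := by
  rw [PiLp.inner_apply]
  exact Finset.sum_congr rfl fun i _ => by simp [mul_comm]

lemma sum_star_mul_self {n : ℕ} (x : EuclideanSpace ℂ (Fin n)) :
    ∑ i, star (x i) * x i = ((‖x‖ ^ 2 : ℝ) : ℂ) := by
  rw [sum_star_mul_eq_inner, inner_self_eq_norm_sq_to_K]
  simp

open scoped Kronecker in
/-- The mutual information between the reflection coefficient and the received signal. -/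
lemma mutualInfo_echo_add {Ω : Type*} [MeasurableSpace Ω] {Q : Measure Ω}
    [IsProbabilityMeasure Q] {pc ps α : ℝ} (hpc : 0 ≤ pc) (hps : 0 ≤ ps)
    {hc hs : EuclideanSpace ℂ (Fin N)} (hhs : hs ≠ 0) (w : EuclideanSpace ℂ (Fin N))
    {ss : EuclideanSpace ℂ (Fin L)} (hss : ‖ss‖ ^ 2 = L) (hL : 0 < L)
    {β : Ω → ℂ} (hβ : IsScalarCSCG β α Q) {Z : Ω → Matrix (Fin N) (Fin L) ℂ}
    (hZ : IsCSCG (fun ω => (Z ω).vec) ((1 : Matrix (Fin L) (Fin L) ℂ) ⊗ₖ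
        (1 + (pc : ℂ) • Matrix.vecMulVec hc.ofLp (star hc.ofLp))) Q)
    (hβZ : IndepFun β (fun ω => (Z ω).vec) Q) :
    mutualInfo (fun ω => (echo ps hs w ss (β ω) + Z ω).vec) β Q =
      ENNReal.ofReal (Real.log (1 + α *
        (ps * ‖hs.ofLp ⬝ᵥ w.ofLp‖ ^ 2 * L * whitenedGain pc hc hs))) := by
  simp_rw [vec_echo_add]
  set d : ℂ := Real.sqrt ps * (hs.ofLp ⬝ᵥ w.ofLp) with hd
  have hd2 : ‖d‖ ^ 2 = ps * ‖hs.ofLp ⬝ᵥ w.ofLp‖ ^ 2 := by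
    rw [hd, norm_mul, mul_pow, Complex.norm_real, Real.norm_of_nonneg (Real.sqrt_nonneg _),
      Real.sq_sqrt hps]
  rw [← hd2]
  have hκ := whitenedGain_pos hpc hc hhs
  have hL' : (0 : ℝ) < L := by exact_mod_cast hL
  -- If `d = 0` the echo vanishes and no matched filter exists; the observation is pure noise,
  -- independent of `β`, and both sides are 0.
  by_cases hd0 : d = 0
  · have ha : echoVec ps hs w ss = 0 := by
      ext k
      simp only [echoVec, ← hd, hd0, zero_mul, Pi.zero_apply]
    simp only [ha, smul_zero, zero_add, hd0, norm_zero]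
    rw [mutualInfo_eq_zero_of_indepFun hZ.hasGaussianLaw.aemeasurable
      hβ.gaussianLaw.aemeasurable hβZ.symm]
    simp
  have hq : 0 < ‖d‖ ^ 2 * L * whitenedGain pc hc hs := by positivity
  set q := ‖d‖ ^ 2 * L * whitenedGain pc hc hs with hqdef
  set D : ℂ := 1 + pc * ((‖hc‖ ^ 2 : ℝ) : ℂ) with hD
  have hD0 : D ≠ 0 := by
    have : (1 + pc * ‖hc‖ ^ 2 : ℝ) ≠ 0 := by positivity
    rw [hD]
    exact_mod_cast this
  -- The row vector `h_sᴴ (I + p_c h_c h_cᴴ)⁻¹`, written out by the Sherman–Morrison formula.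
  let f : Fin N → ℂ := fun i => star (hs i) - pc * inner ℂ hs hc / D * star (hc i)
  have hfhs : ∑ i, f i * hs i = (whitenedGain pc hc hs : ℂ) := by
    have h : inner ℂ hs hc * inner ℂ hc hs = ((‖inner ℂ hs hc‖ ^ 2 : ℝ) : ℂ) := by
      rw [← inner_conj_symm hc hs, Complex.mul_conj, Complex.normSq_eq_norm_sq]
    simp only [f, sub_mul, Finset.sum_sub_distrib, mul_assoc, ← Finset.mul_sum,
      sum_star_mul_self, sum_star_mul_eq_inner, whitenedGain]
    push_cast at h hD ⊢
    rw [← hD, ← h]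
    ring
  have hfhc : ∑ i, f i * hc i = inner ℂ hs hc / D := by
    simp only [f, sub_mul, Finset.sum_sub_distrib, mul_assoc, ← Finset.mul_sum,
      sum_star_mul_self, sum_star_mul_eq_inner]
    field_simp
    rw [hD]
    ring
  have hss' : ∑ j, ss j * star (ss j) = (L : ℂ) := by
    simp_rw [mul_comm (ss _)]
    rw [sum_star_mul_self, hss]
    simp
  have hdd : star d * d = ((‖d‖ ^ 2 : ℝ) : ℂ) := by
    rw [mul_comm, Complex.star_def, Complex.mul_conj, Complex.normSq_eq_norm_sq]
  -- This is `q⁻¹ aᴴ R⁻¹`: the identity factor of `R` leaves the pulse untouched, so only the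
  -- spatial factor `f` is whitened.
  let c : Fin L × Fin N → ℂ := fun k => (q : ℂ)⁻¹ * star d * ss k.1 * f k.2
  refine mutualInfo_smul_add_eq_log hβ hZ hβZ (c := c) hq ?_ fun k => ?_
  · have : c ⬝ᵥ echoVec ps hs w ss =
        (q : ℂ)⁻¹ * (star d * d) * ((∑ j, ss j * star (ss j)) * ∑ i, f i * hs i) := by
      rw [Finset.sum_mul_sum, Finset.mul_sum, dotProduct, Fintype.sum_prod_type]
      refine Finset.sum_congr rfl fun j _ => ?_
      rw [Finset.mul_sum]
      refine Finset.sum_congr rfl fun i _ => ?_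
      simp only [c, echoVec, ← hd]
      ring
    rw [this, hdd, hss', hfhs]
    have hq0 : (q : ℂ) ≠ 0 := by exact_mod_cast hq.ne'
    rw [mul_assoc, inv_mul_eq_div, div_eq_one_iff_eq hq0, hqdef]
    push_cast
    ring
  · obtain ⟨j, i⟩ := k
    have h1 : ∑ i', f i' * (1 + (pc : ℂ) • Matrix.vecMulVec hc.ofLp (star hc.ofLp)) i' i =
        star (hs i) := by
      have : ∀ i', f i' * (1 + (pc : ℂ) • Matrix.vecMulVec hc.ofLp (star hc.ofLp)) i' i =
          f i' * (1 : Matrix (Fin N) (Fin N) ℂ) i' i + pc * star (hc i) * (f i' * hc i') :=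
        fun i' => by
          simp only [Matrix.add_apply, Matrix.smul_apply, Matrix.vecMulVec_apply, Pi.star_apply,
            smul_eq_mul]
          ring
      simp_rw [this]
      rw [Finset.sum_add_distrib, ← Finset.mul_sum, hfhc]
      simp only [Matrix.one_apply, mul_ite, mul_one, mul_zero, Finset.sum_ite_eq',
        Finset.mem_univ, if_true, f]
      ring
    have h2 : Matrix.vecMul c ((1 : Matrix (Fin L) (Fin L) ℂ) ⊗ₖ
        (1 + (pc : ℂ) • Matrix.vecMulVec hc.ofLp (star hc.ofLp))) (j, i) =
        (q : ℂ)⁻¹ * star d * ss j *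
          ∑ i', f i' * (1 + (pc : ℂ) • Matrix.vecMulVec hc.ofLp (star hc.ofLp)) i' i := by
      rw [Matrix.vecMul, dotProduct, Fintype.sum_prod_type, Finset.sum_eq_single j]
      · rw [Finset.mul_sum]
        refine Finset.sum_congr rfl fun i' _ => ?_
        rw [Matrix.kroneckerMap_apply, Matrix.one_apply_eq]
        ring
      · intro j' _ hj
        refine Finset.sum_eq_zero fun i' _ => ?_
        rw [Matrix.kroneckerMap_apply, Matrix.one_apply_ne hj]
        ring
      · simp
    rw [h2, h1]
    simp only [echoVec, ← hd, star_mul', star_star]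
    ring

/-- The bilinear pairing is the inner product with the entrywise conjugate, which has the same norm,
so Cauchy–Schwarz applies. -/
lemma norm_dotProduct_le (x y : EuclideanSpace ℂ (Fin N)) :
    ‖x.ofLp ⬝ᵥ y.ofLp‖ ≤ ‖x‖ * ‖y‖ := by
  have h := norm_inner_le_norm (𝕜 := ℂ) (WithLp.toLp 2 (star x.ofLp)) y
  have hx : ‖(WithLp.toLp 2 (star x.ofLp) : EuclideanSpace ℂ (Fin N))‖ = ‖x‖ := by
    simp [EuclideanSpace.norm_eq]
  rw [← sum_star_mul_eq_inner, hx] at h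
  simpa [dotProduct] using h

lemma dotProduct_sensingBeamformer {hs : EuclideanSpace ℂ (Fin N)} (hhs : hs ≠ 0) :
    hs.ofLp ⬝ᵥ (sensingBeamformer hs).ofLp = (‖hs‖ : ℂ) := by
  have h0 : (‖hs‖ : ℂ) ≠ 0 := by simpa using hhs
  have h : hs.ofLp ⬝ᵥ (sensingBeamformer hs).ofLp =
      ((‖hs‖⁻¹ : ℝ) : ℂ) * ∑ i, star (hs i) * hs i := by
    rw [Finset.mul_sum]
    refine Finset.sum_congr rfl fun i _ => ?_
    simp [sensingBeamformer]
    ring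
  rw [h, sum_star_mul_self]
  push_cast
  field_simp

end Uplink

end UplinkISAC

/-- The physical communication signal `s_c` and noise `N_u` live on `(Ω, P)`. Treating
`Z_c = √p_c h_c s_cᴴ + N_u` as Gaussian noise means replacing it by a circularly symmetric complex
Gaussian `Z`, independent of `β`, with the covariance matrix `E{vec(Z_c) vec(Z_c)ᴴ}`; the pair
`(β, Z)` lives on `(Ω', Q)`, which may be the same space. -/
theorem theorem7 {N L : ℕ} (hL : 0 < L)
    (pc ps αs : ℝ) (hpc : 0 ≤ pc) (hps : 0 ≤ ps) (hαs : 0 ≤ αs)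
    (hc hs : EuclideanSpace ℂ (Fin N)) (hhs : hs ≠ 0)
    (ss : EuclideanSpace ℂ (Fin L)) (hss : (L : ℝ)⁻¹ * ‖ss‖ ^ 2 = 1)
    {Ω : Type*} [MeasurableSpace Ω] (P : Measure Ω) [IsProbabilityMeasure P]
    (sc : Ω → Fin L → ℂ) (hsc_meas : AEMeasurable sc P)
    (hsc : UplinkISAC.secondMoment sc P = 1)
    (Nu : Ω → Matrix (Fin N) (Fin L) ℂ)
    (hNu : UplinkISAC.IsCSCG (fun ω => (Nu ω).vec) 1 P)
    (hscNu : IndepFun sc (fun ω => (Nu ω).vec) P)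
    {Ω' : Type*} [MeasurableSpace Ω'] (Q : Measure Ω') [IsProbabilityMeasure Q]
    (β : Ω' → ℂ) (hβ : UplinkISAC.IsScalarCSCG β αs Q)
    (Z : Ω' → Matrix (Fin N) (Fin L) ℂ)
    (hZ : UplinkISAC.IsCSCG (fun ω => (Z ω).vec)
      (UplinkISAC.secondMoment
        (fun ω => (UplinkISAC.interferencePlusNoise pc hc (sc ω) (Nu ω)).vec) P) Q)
    (hβZ : IndepFun β (fun ω => (Z ω).vec) Q) :
    UplinkISAC.sensingRate ps hs (UplinkISAC.sensingBeamformer hs) ss β Z Q ≠ ∞ ∧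
    (UplinkISAC.sensingRate ps hs (UplinkISAC.sensingBeamformer hs) ss β Z Q).toReal =
      1 / (L : ℝ) * Real.logb 2 (1 + ps * L * αs * ‖hs‖ ^ 2 *
        (‖hs‖ ^ 2 - pc * ‖inner ℂ hs hc‖ ^ 2 / (1 + pc * ‖hc‖ ^ 2))) ∧
    ∀ w : EuclideanSpace ℂ (Fin N), ‖w‖ = 1 →
      UplinkISAC.sensingRate ps hs w ss β Z Q ≤
        UplinkISAC.sensingRate ps hs (UplinkISAC.sensingBeamformer hs) ss β Z Q := by
  have hL' : (0 : ℝ) < L := by exact_mod_cast hL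
  have hss' : ‖ss‖ ^ 2 = L := by
    rw [inv_mul_eq_div, div_eq_one_iff_eq hL'.ne'] at hss
    exact hss
  rw [UplinkISAC.secondMoment_interferencePlusNoise hpc hc hsc_meas hsc hNu hscNu] at hZ
  have hMI := fun w => UplinkISAC.mutualInfo_echo_add hpc hps hhs w hss' hL hβ hZ hβZ
  have hκ := UplinkISAC.whitenedGain_pos hpc hc hhs
  have hlog2 : 0 < Real.log 2 := Real.log_pos one_lt_two
  have hL0 : (L : ℝ≥0∞) ≠ 0 := by exact_mod_cast hL.ne'
  have hrate : ∀ w, UplinkISAC.sensingRate ps hs w ss β Z Q =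
      ENNReal.ofReal (Real.log (1 + αs * (ps * ‖hs.ofLp ⬝ᵥ w.ofLp‖ ^ 2 * L *
        UplinkISAC.whitenedGain pc hc hs))) / ENNReal.ofReal (Real.log 2) / (L : ℝ≥0∞) :=
    fun w => by rw [UplinkISAC.sensingRate, UplinkISAC.mutualInfoBits, hMI]
  have hnorm : ‖hs.ofLp ⬝ᵥ (UplinkISAC.sensingBeamformer hs).ofLp‖ = ‖hs‖ := by
    rw [UplinkISAC.dotProduct_sensingBeamformer hhs]
    simp
  have hlog2' : ENNReal.ofReal (Real.log 2) ≠ 0 := by simpa using hlog2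
  refine ⟨?_, ?_, fun w hw => ?_⟩
  · rw [hrate]
    exact ENNReal.div_ne_top (ENNReal.div_ne_top ENNReal.ofReal_ne_top hlog2') hL0
  · rw [hrate, hnorm, ENNReal.toReal_div, ENNReal.toReal_div, ENNReal.toReal_natCast,
      ENNReal.toReal_ofReal hlog2.le, ENNReal.toReal_ofReal (Real.log_nonneg (by
        have : 0 ≤ αs * (ps * ‖hs‖ ^ 2 * L * UplinkISAC.whitenedGain pc hc hs) := by positivity
        linarith)), Real.logb, UplinkISAC.whitenedGain]
    rw [one_div, inv_mul_eq_div]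
    congr 4
    ring
  -- Only `|h_sᵀ w|` depends on `w`, and the rate is monotone in it because `αs`, `ps` and the
  -- whitened gain are nonnegative.
  · rw [hrate, hrate, hnorm]
    have hle : ‖hs.ofLp ⬝ᵥ w.ofLp‖ ≤ ‖hs‖ := by
      simpa [hw] using UplinkISAC.norm_dotProduct_le hs w
    gcongr
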